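/- Values are Booleans, rational numbers and finite lists of values; states map the program variables to values. Commands $C$ are built from skip, assignment, sequential composition, conditionals, while loops, nondeterministic choice $C_1 \mathbin{\&} C_2$ and probabilistic choice $C_1\oplus_e C_2$. Their demonic denotational semantics $[\![C]\!](\sigma)$ is a set of probability distributions on the set of states together with a divergence element $\bot$: nondeterministic choice yields all convex combinations $p\mu+(1-p)\nu$ $(p\in[0,1])$ of outcomes of the two branches, and a loop is the least fixed point, for the order of reverse inclusion, of its unrolling. A distribution satisfies $\lceil P\rceil$ if its support consists of states that satisfy $P$ (so that $\bot$ has probability $0$). The triple $\langle\varphi\rangle\,C\,\langle\psi\rangle$ is valid if for every initial distribution that satisfies $\varphi$, every final distribution that $C$ can produce from it satisfies $\psi$, regardless of how the nondeterminism is resolved. Let $F$ be a 3-CNF formula with clauses $1,\dots,M$ over Boolean variables $x_1,\dots,x_N$ (a variable may occur several times in a clause). Let $\mathit{evalclause}(i)$ be the Boolean expression that states that clause $i$ is true under the assignment stored in the list variable $\mathit{vars}$, whose entry $\mathit{vars}[k]$ is the value of $x_k$, and let $\mathit{eval}=\mathit{evalclause}(1)\wedge\dots\wedge\mathit{evalclause}(M)$.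 (Lists are indexed from $1$; an access outside of the list yields $0$, an update beyond the end of the list fills the gap with zeros, and an update of a value that is not a list yields $0$. As truth values, $1$ counts as true and $0$ as false, and so does every other value that is not the Boolean true.) The partial rejection sampler PRS is the program $$b:=\mathit{eval};\ \textbf{while } \neg b \textbf{ do } (\mathit{selclause};\ \mathit{resampleclause};\ b:=\mathit{eval}).$$ Here $\mathit{selclause}$ sets $s:=-1$ and then, for $i=1,\dots,M$ in turn, does the following if clause $i$ is not satisfied: if $s=-1$ it sets $s:=i$, and otherwise it executes $\mathbf{skip}\mathbin{\&}(s:=i)$. In this way it picks nondeterministically an unsatisfied clause $s$. The program $\mathit{resampleclause}$ resamples the three variables of clause $s$ one after the other, setting each entry of $\mathit{vars}$ to true or false with probability $\tfrac12$ each. Assume that $F$ has a satisfying assignment. Then the triple $$\langle\lceil \mathit{vars}\text{ is a list}\rceil\rangle\ \mathrm{PRS}\ \langle\lceil \mathit{eval}=\mathrm{true}\rceil\rangle$$ is valid. In particular, from every initial state in which $\mathit{vars}$ holds a list (of any length and with any entries; the other program variables are arbitrary), and for every strategy of resolving the nondeterministic choice of the unsatisfied clause, PRS terminates almost surely, and every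 final state that is reached with positive probability stores a satisfying assignment of $F$ in $\mathit{vars}$. -/

import Mathlib

namespace DemonicOL

/-! ## Values, expressions and states -/

/-- Values: Booleans, rational numbers and finite lists of values. -/
inductive Val : Type
  | bool : Bool → Val
  | num : ℚ → Val
  | list : List Val → Val

/-- The truth value of a value. The numbers `1` and `0` are the bits true and false;
everything that is neither `true` nor `1` counts as false. -/
def Val.truth : Val → Bool
  | .bool t => t
  | .num q => decide (q = 1)
  | .list _ => false

/-- Program states assign values to variables. -/
abbrev State (Var : Type) : Type := Var → Val

/-- Expressions. -/
inductive Exp (Var : Type) : Type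
  | var : Var → Exp Var
  | bool : Bool → Exp Var
  | num : ℚ → Exp Var
  | not : Exp Var → Exp Var
  | and : Exp Var → Exp Var → Exp Var
  | or : Exp Var → Exp Var → Exp Var
  | xnor : Exp Var → Exp Var → Exp Var
  | eq : Exp Var → Exp Var → Exp Var
  | le : Exp Var → Exp Var → Exp Var
  | add : Exp Var → Exp Var → Exp Var
  /-- list literal `⟨e₁, …, eₙ⟩` -/
  | list : {n : ℕ} → (Fin n → Exp Var) → Exp Var
  /-- list access `e₁[e₂]` -/
  | get : Exp Var → Exp Var → Exp Var
  /-- list update `e₁[e₂ ↦ e₃]` -/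
  | set : Exp Var → Exp Var → Exp Var → Exp Var

/-- Comparison of numbers (false on values that are not numbers). -/
def Val.le : Val → Val → Bool
  | .num p, .num q => decide (p ≤ q)
  | _, _ => false

/-- Addition of numbers (`0` on values that are not numbers). -/
def Val.add : Val → Val → Val
  | .num p, .num q => .num (p + q)
  | _, _ => .num 0

/-- The value as a list index (lists are indexed from `1`), if it is a positive integer. -/
def Val.index : Val → Option ℕ
  | .num q => if q.den = 1 ∧ 1 ≤ q.num then some q.num.toNat else none
  | _ => none

/-- List access: the `k`-th entry, counted from `1`, or `0` if there is none. -/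
def Val.get : Val → Val → Val
  | .list l, w =>
    match w.index with
    | some k => l.getD (k - 1) (.num 0)
    | none => .num 0
  | _, _ => .num 0

/-- List update at the `k`-th position, counted from `1`. An update beyond the end of the list
fills the gap with zeros; the result is `0` if the first argument is not a list or the second one
is not a positive integer. -/
def Val.set : Val → Val → Val → Val
  | .list l, w, v =>
    match w.index with
    | some k => .list (List.ofFn fun j : Fin (max k l.length) =>
        if (j : ℕ) + 1 = k then v else l.getD j (.num 0))
    | none => .num 0
  | _, _, _ => .num 0

open Classical in
/-- Evaluation of expressions. -/
noncomputable def Exp.eval {Var : Type} : Exp Var → State Var → Val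
  | .var x, σ => σ x
  | .bool t, _ => .bool t
  | .num q, _ => .num q
  | .not e, σ => .bool (!(e.eval σ).truth)
  | .and e f, σ => .bool ((e.eval σ).truth && (f.eval σ).truth)
  | .or e f, σ => .bool ((e.eval σ).truth || (f.eval σ).truth)
  | .xnor e f, σ => .bool ((e.eval σ).truth == (f.eval σ).truth)
  | .eq e f, σ => .bool (decide (e.eval σ = f.eval σ))
  | .le e f, σ => .bool ((e.eval σ).le (f.eval σ))
  | .add e f, σ => (e.eval σ).add (f.eval σ)
  | .list es, σ => .list (List.ofFn fun k => (es k).eval σ)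
  | .get e f, σ => (e.eval σ).get (f.eval σ)
  | .set e f g, σ => (e.eval σ).set (f.eval σ) (g.eval σ)

/-- The value as a probability, for numbers in `[0, 1]`. (Other numbers are moved to the nearest
point of `[0, 1]`, and values that are not numbers are read as `0`.) -/
noncomputable def Val.prob : Val → unitInterval
  | .num q => Set.projIcc 0 1 zero_le_one (q : ℝ)
  | _ => 0

/-! ## Sets of distributions

For a type `X`, the type `Option X` is `X` with the additional element `⊥ = none` that stands for
divergence; `PMF (Option X)` is the type of discrete probability distributions on it. -/

/-- `μ ⊑ ν` iff `μ x ≤ ν x` for all proper elements `x`. -/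
def distLE {X : Type} (μ ν : PMF (Option X)) : Prop := ∀ x : X, μ (some x) ≤ ν (some x)

/-- The up-closure of a set of distributions. -/
def upcl {X : Type} (S : Set (PMF (Option X))) : Set (PMF (Option X)) :=
  {ν | ∃ μ ∈ S, distLE μ ν}

/-- The unit `η`, defined on `X` together with `⊥`: the up-closure of the point mass. -/
noncomputable def unit {X : Type} (x : Option X) : Set (PMF (Option X)) := upcl {PMF.pure x}

/-- The extension of `f` to `⊥`. -/
noncomputable def extendBot {X Y : Type} (f : X → Set (PMF (Option Y))) :
    Option X → Set (PMF (Option Y))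
  | some x => f x
  | none => unit none

/-- The Kleisli extension `f†`: the distributions `∑ x, μ x • ν x` with `μ ∈ S` and `ν x` in the
value of `f` at `x` for every `x` in the support of `μ`. -/
noncomputable def kleisli {X Y : Type} (f : X → Set (PMF (Option Y))) (S : Set (PMF (Option X))) :
    Set (PMF (Option Y)) :=
  {ξ | ∃ μ ∈ S, ∃ ν : Option X → PMF (Option Y),
    (∀ x ∈ μ.support, ν x ∈ extendBot f x) ∧ ξ = μ.bind ν}

/-- `ξ = p • μ + (1 - p) • ν`. -/
def IsMix {X : Type} (p : unitInterval) (μ ν ξ : PMF X) : Prop :=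
  ∀ x, ξ x = ENNReal.ofReal p * μ x + ENNReal.ofReal (1 - p) * ν x

/-- Probabilistic choice between two sets of distributions. -/
def oplus {X : Type} (p : unitInterval) (S T : Set (PMF X)) : Set (PMF X) :=
  {ξ | ∃ μ ∈ S, ∃ ν ∈ T, IsMix p μ ν ξ}

/-- Nondeterministic choice: the union of all the probabilistic choices. -/
def nd {X : Type} (S T : Set (PMF X)) : Set (PMF X) := ⋃ p : unitInterval, oplus p S T

/-! ## Commands and their semantics -/

/-- The commands of the language. -/
inductive Cmd (Var : Type) : Type
  | skip : Cmd Var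
  | assign : Var → Exp Var → Cmd Var
  | seq : Cmd Var → Cmd Var → Cmd Var
  | nd : Cmd Var → Cmd Var → Cmd Var
  | prob : Exp Var → Cmd Var → Cmd Var → Cmd Var
  | ite : Exp Var → Cmd Var → Cmd Var → Cmd Var
  | while : Exp Var → Cmd Var → Cmd Var

/-- Maps from states to sets of distributions over final states and `⊥`. -/
abbrev Den (Var : Type) : Type := State Var → Set (PMF (Option (State Var)))

open Classical in
/-- One unrolling of `while e do C`, where `c` is the denotation of `C`. -/
noncomputable def unroll {Var : Type} (e : Exp Var) (c f : Den Var) : Den Var := fun σ =>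
  if e.eval σ = .bool true then kleisli f (c σ) else unit (some σ)

theorem unroll_mono {Var : Type} (e : Exp Var) (c : Den Var) {f g : Den Var} (h : f ≤ g) :
    unroll e c f ≤ unroll e c g := by
  intro σ ξ hξ
  unfold unroll at hξ ⊢
  split_ifs at hξ ⊢ with he
  · obtain ⟨μ, hμ, ν, hν, rfl⟩ := hξ
    refine ⟨μ, hμ, ν, fun x hx => ?_, rfl⟩
    have := hν x hx
    cases x with
    | none => exact this
    | some y => exact h y this
  · exact hξ

/-- The characteristic function of a loop, as a monotone map for the order on denotations, which
is the pointwise *reverse* inclusion (whence the order dual). -/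
noncomputable def charFun {Var : Type} (e : Exp Var) (c : Den Var) :
    (Den Var)ᵒᵈ →o (Den Var)ᵒᵈ where
  toFun f := OrderDual.toDual (unroll e c (OrderDual.ofDual f))
  monotone' _ _ h := unroll_mono e c h

open Classical in
/-- The denotational semantics. Loops are least fixed points for reverse inclusion. -/
noncomputable def Cmd.sem {Var : Type} : Cmd Var → Den Var
  | .skip => fun σ => unit (some σ)
  | .assign x e => fun σ => unit (some (Function.update σ x (e.eval σ)))
  | .seq C₁ C₂ => fun σ => kleisli C₂.sem (C₁.sem σ)
  | .nd C₁ C₂ => fun σ => DemonicOL.nd (C₁.sem σ) (C₂.sem σ)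
  | .prob e C₁ C₂ => fun σ => oplus (e.eval σ).prob (C₁.sem σ) (C₂.sem σ)
  | .ite e C₁ C₂ => fun σ => if e.eval σ = .bool true then C₁.sem σ else C₂.sem σ
  | .while e C => OrderDual.ofDual (OrderHom.lfp (charFun e C.sem))

/-- Almost sure termination on the initial state `σ`. -/
def Cmd.AlmostSurelyTerminates {Var : Type} (C : Cmd Var) (σ : State Var) : Prop :=
  ∀ μ ∈ C.sem σ, none ∉ μ.support

/-! ## Outcome assertions and triples -/

/-- Atomic assertions about states. -/
inductive Atom (Var : Type) : Type
  | tt : Atom Var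
  | ff : Atom Var
  | and : Atom Var → Atom Var → Atom Var
  | or : Atom Var → Atom Var → Atom Var
  | not : Atom Var → Atom Var
  | eq : Exp Var → Exp Var → Atom Var
  | le : Exp Var → Exp Var → Atom Var
  /-- the value of the expression is a list -/
  | isList : Exp Var → Atom Var

/-- The set of states that satisfy an atomic assertion. -/
def Atom.sem {Var : Type} : Atom Var → Set (State Var)
  | .tt => Set.univ
  | .ff => ∅
  | .and P Q => P.sem ∩ Q.sem
  | .or P Q => P.sem ∪ Q.sem
  | .not P => P.semᶜ
  | .eq e f => {σ | e.eval σ = f.eval σ}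
  | .le e f => {σ | (e.eval σ).le (f.eval σ) = true}
  | .isList e => {σ | ∃ l, e.eval σ = .list l}

/-- Outcome assertions. -/
inductive Assertion (Var : Type) : Type
  | top : Assertion Var
  | bot : Assertion Var
  | and : Assertion Var → Assertion Var → Assertion Var
  | oplus : unitInterval → Assertion Var → Assertion Var → Assertion Var
  | nd : Assertion Var → Assertion Var → Assertion Var
  /-- `⌈P⌉` -/
  | sure : Atom Var → Assertion Var

/-- Satisfaction of an outcome assertion by a distribution. -/
def Assertion.Sat {Var : Type} : Assertion Var → PMF (Option (State Var)) → Prop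
  | .top, _ => True
  | .bot, _ => False
  | .and φ ψ, μ => φ.Sat μ ∧ ψ.Sat μ
  | .oplus p φ ψ, μ => ∃ μ₁ μ₂, IsMix p μ₁ μ₂ μ ∧ φ.Sat μ₁ ∧ ψ.Sat μ₂
  | .nd φ ψ, μ => ∃ p μ₁ μ₂, IsMix p μ₁ μ₂ μ ∧ φ.Sat μ₁ ∧ ψ.Sat μ₂
  | .sure P, μ => μ.support ⊆ some '' P.sem

/-- Validity of the triple `⟨φ⟩ C ⟨ψ⟩`. -/
def Valid {Var : Type} (φ : Assertion Var) (C : Cmd Var) (ψ : Assertion Var) : Prop :=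
  ∀ μ, φ.Sat μ → ∀ ν ∈ kleisli C.sem (upcl {μ}), ψ.Sat ν

/-! ## The SAT solver -/

/-- A 3-CNF formula with `M` clauses over `N` Boolean variables. The `j`-th literal of clause `i`
is the variable `var i j`, negated iff `sign i j = false`. A variable may be repeated in a
clause. -/
structure ThreeCNF (N M : ℕ) where
  var : Fin M → Fin 3 → Fin N
  sign : Fin M → Fin 3 → Bool

/-- The truth assignment `x` satisfies the formula. -/
def ThreeCNF.Satisfies {N M : ℕ} (F : ThreeCNF N M) (x : Fin N → Bool) : Prop :=
  ∀ i, ∃ j, x (F.var i j) = F.sign i j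

/-- The four program variables that the solver uses. -/
structure SolverVars (Var : Type) where
  b : Var
  s : Var
  i : Var
  vars : Var
  distinct : [b, s, i, vars].Nodup

/-- `x := flip(e)` for the entry `x[k]` of a list. -/
def flipEntry {Var : Type} (x : Var) (k e : Exp Var) : Cmd Var :=
  .prob e (.assign x (.set (.var x) k (.bool true))) (.assign x (.set (.var x) k (.bool false)))

section Solver

variable {Var : Type} {N M : ℕ} (V : SolverVars Var) (F : ThreeCNF N M)

/-- The `M × 3` list literal of the variables of the clauses (numbered from `1`). -/
def clvars : Exp Var := .list fun i => .list fun j => .num (((F.var i j : ℕ) : ℚ) + 1)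

/-- The `M × 3` list literal of the signs of the literals: `0` if negated, `1` otherwise. -/
def clsigns : Exp Var := .list fun i => .list fun j => .num (if F.sign i j then 1 else 0)

/-- `clsigns[e][j] ⊙ vars[clvars[e][j]]` -/
def evalLit (e : Exp Var) (j : ℚ) : Exp Var :=
  .xnor (.get (.get (clsigns F) e) (.num j))
    (.get (.var V.vars) (.get (.get (clvars F) e) (.num j)))

/-- `evalclause(e)` -/
def evalClause (e : Exp Var) : Exp Var :=
  .or (evalLit V F e 1) (.or (evalLit V F e 2) (evalLit V F e 3))

/-- `eval`, the conjunction of `evalclause(1)`, …, `evalclause(M)` -/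
def evalFormula : Exp Var :=
  (List.finRange M).foldr
    (fun (k : Fin M) acc => .and (evalClause V F (.num (((k : ℕ) : ℚ) + 1))) acc) (.bool true)

/-- Select some unsatisfied clause `s`. -/
def selClause : Cmd Var :=
  .seq (.assign V.s (.num (-1))) <|
  .seq (.assign V.i (.num 1)) <|
  .while (.le (.var V.i) (.num M)) <|
    .seq
      (.ite (.not (evalClause V F (.var V.i)))
        (.ite (.eq (.var V.s) (.num (-1)))
          (.assign V.s (.var V.i))
          (.nd .skip (.assign V.s (.var V.i))))
        .skip)
      (.assign V.i (.add (.var V.i) (.num 1)))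

/-- `vars[clvars[s][j]] := flip(1/2)` -/
def resampleVar (j : ℚ) : Cmd Var :=
  flipEntry V.vars (.get (.get (clvars F) (.var V.s)) (.num j)) (.num (1 / 2))

/-- Resample the three variables of clause `s`. -/
def resampleClause : Cmd Var :=
  .seq (resampleVar V F 1) (.seq (resampleVar V F 2) (resampleVar V F 3))

/-- The partial rejection sampling SAT solver. -/
def PRS : Cmd Var :=
  .seq (.assign V.b (evalFormula V F)) <|
  .while (.not (.var V.b)) <|
    .seq (selClause V F) (.seq (resampleClause V F) (.assign V.b (evalFormula V F)))

/-- The truth assignment that is stored in the list `vars` of a state. -/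
def storedAssignment (σ : State Var) : Fin N → Bool :=
  fun k => ((σ V.vars).get (.num (((k : ℕ) : ℚ) + 1))).truth

end Solver

end DemonicOL

/-! Fix a satisfying assignment `x` and measure a state by the Hamming distance between its stored
assignment and `x`. A clause that is currently false contains a variable on which the two differ.
Whichever false clause the adversary selects, the three fair flips therefore reproduce the values of
`x` with probability 1/8, and the distance then drops (`card_disagreements_lt`). Otherwise the
distance may be anything.

Let `r` be the supremum, over all invariant states and all strategies, of the probability that the
loop diverges or stops in an unsatisfying state. Induction on the distance `d` gives a constant `c <
1` such that failure from distance at most `d` has probability at most `c * r`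
(`exists_wp_mainLoop_le`). Since every distance is at most `N`, this yields `r ≤ c * r` with `r ≤
1`, hence `r = 0` (`wp_mainLoop_eq_zero`).

Two calculi support this: upper bounds for worst-case expectations (`wp`) for the probabilistic
part, and support bounds (`Ensures`) for the selection loop, which always stops after `M` rounds. -/

namespace DemonicOL

open scoped ENNReal

/-! ## Expectations and supports of sets of distributions -/

section General

variable {X Y Z : Type}

/-- Both total masses are 1, so `ν` can exceed `μ` on proper elements only by using mass that `μ`
gives to `⊥`. Up-closure is thus harmless in the absence of divergence. -/
theorem eq_of_distLE {μ ν : PMF (Option X)} (h : distLE μ ν) (h0 : μ none = 0) : ν = μ := by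
  have hle : ∀ x, μ x ≤ ν x := by
    rintro (_ | x)
    · simp [h0]
    · exact h x
  refine PMF.ext fun x => (le_antisymm (hle x) ?_).symm
  by_contra! hx
  have := ENNReal.tsum_lt_tsum (by simp [μ.tsum_coe]) hle hx
  simp [PMF.tsum_coe] at this

theorem mem_unit_some {x : X} {ν : PMF (Option X)} : ν ∈ unit (some x) ↔ ν = PMF.pure (some x) := by
  constructor
  · rintro ⟨μ, rfl, h⟩
    exact eq_of_distLE h (by simp [PMF.pure_apply])
  · rintro rfl
    exact ⟨_, rfl, fun _ => le_rfl⟩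

/-- The expected value of `g`. -/
noncomputable def expect (μ : PMF X) (g : X → ℝ≥0∞) : ℝ≥0∞ := ∑' x, μ x * g x

theorem expect_le {μ : PMF X} {g : X → ℝ≥0∞} {r : ℝ≥0∞} (h : ∀ x ∈ μ.support, g x ≤ r) :
    expect μ g ≤ r := by
  calc expect μ g ≤ ∑' x, μ x * r := by
        refine ENNReal.tsum_le_tsum fun x => ?_
        by_cases hx : μ x = 0
        · simp [hx]
        · gcongr
          exact h x hx
    _ = r := by rw [ENNReal.tsum_mul_right, μ.tsum_coe, one_mul]

theorem expect_pure (x : X) (g : X → ℝ≥0∞) : expect (PMF.pure x) g = g x := by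
  classical
  unfold expect
  rw [tsum_eq_single x]
  · simp
  · intro y hy
    simp [PMF.pure_apply, hy]

theorem expect_bind (μ : PMF X) (ν : X → PMF Y) (g : Y → ℝ≥0∞) :
    expect (μ.bind ν) g = expect μ fun x => expect (ν x) g := by
  simp only [expect, PMF.bind_apply, ← ENNReal.tsum_mul_right, ← ENNReal.tsum_mul_left]
  rw [ENNReal.tsum_comm]
  simp only [mul_assoc]

theorem expect_mix {p : unitInterval} {μ ν ξ : PMF X} (h : IsMix p μ ν ξ) (g : X → ℝ≥0∞) :
    expect ξ g = ENNReal.ofReal p * expect μ g + ENNReal.ofReal (1 - p) * expect ν g := by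
  simp only [expect, h _, ← ENNReal.tsum_mul_left, ← ENNReal.tsum_add]
  exact tsum_congr fun x => by ring

/-- The greatest expected value of `g` after `f`; after divergence anything is possible. -/
noncomputable def wp (f : X → Set (PMF (Option Y))) (g : Option Y → ℝ≥0∞) : Option X → ℝ≥0∞
  | some x => ⨆ μ ∈ f x, expect μ g
  | none => ⨆ y, g y

theorem wp_some_le {f : X → Set (PMF (Option Y))} {g : Option Y → ℝ≥0∞} {x : X} {r : ℝ≥0∞} :
    wp f g (some x) ≤ r ↔ ∀ μ ∈ f x, expect μ g ≤ r := by
  simp [wp]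

theorem expect_le_wp {f : X → Set (PMF (Option Y))} (g : Option Y → ℝ≥0∞) {x : Option X}
    {μ : PMF (Option Y)} (h : μ ∈ extendBot f x) : expect μ g ≤ wp f g x := by
  cases x with
  | none => exact expect_le fun y _ => le_iSup g y
  | some x => exact wp_some_le.1 le_rfl μ h

theorem expect_kleisli_le {f : X → Set (PMF (Option Y))} {S : Set (PMF (Option X))}
    {ξ : PMF (Option Y)} (h : ξ ∈ kleisli f S) (g : Option Y → ℝ≥0∞) :
    ∃ μ ∈ S, expect ξ g ≤ expect μ (wp f g) := by
  obtain ⟨μ, hμ, ν, hν, rfl⟩ := h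
  refine ⟨μ, hμ, ?_⟩
  rw [expect_bind]
  refine ENNReal.tsum_le_tsum fun x => ?_
  by_cases hx : μ x = 0
  · simp [hx]
  · gcongr
    exact expect_le_wp g (hν x hx)

/-- Only this inequality is needed, so no optimal or nearly optimal strategy has to be selected. -/
theorem wp_kleisli_le (h : X → Set (PMF (Option Y))) (f : Y → Set (PMF (Option Z)))
    (g : Option Z → ℝ≥0∞) (x : X) :
    wp (fun x => kleisli f (h x)) g (some x) ≤ wp h (wp f g) (some x) := by
  refine wp_some_le.2 fun ξ hξ => ?_
  obtain ⟨μ, hμ, hle⟩ := expect_kleisli_le hξ g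
  exact hle.trans (wp_some_le.1 le_rfl μ hμ)

theorem wp_mono (f : X → Set (PMF (Option Y))) {g h : Option Y → ℝ≥0∞} (hgh : g ≤ h) :
    wp f g ≤ wp f h := by
  rintro (_ | x)
  · exact iSup_mono hgh
  · refine wp_some_le.2 fun μ hμ => le_trans ?_ (wp_some_le.1 le_rfl μ hμ)
    exact ENNReal.tsum_le_tsum fun y => mul_le_mul_right (hgh y) _

/-! ### Almost sure postconditions -/

/-- Every distribution in `S` is supported by (proper) elements of `P`. -/
def Ensures (S : Set (PMF (Option X))) (P : Set X) : Prop := ∀ μ ∈ S, μ.support ⊆ some '' P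

theorem Ensures.mono {S : Set (PMF (Option X))} {P Q : Set X} (h : Ensures S P) (hPQ : P ⊆ Q) :
    Ensures S Q :=
  fun μ hμ => (h μ hμ).trans (Set.image_mono hPQ)

theorem ensures_unit {x : X} {P : Set X} (hx : x ∈ P) : Ensures (unit (some x)) P := by
  intro μ hμ
  rw [mem_unit_some.1 hμ, PMF.support_pure]
  simpa using hx

theorem ensures_kleisli {f : X → Set (PMF (Option Y))} {S : Set (PMF (Option X))} {P : Set X}
    {Q : Set Y} (hS : Ensures S P) (hf : ∀ x ∈ P, Ensures (f x) Q) : Ensures (kleisli f S) Q := by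
  rintro _ ⟨μ, hμ, ν, hν, rfl⟩ y hy
  obtain ⟨x, hx, hxy⟩ := (PMF.mem_support_bind_iff _ _ _).1 hy
  obtain ⟨x, hxP, rfl⟩ := hS μ hμ hx
  exact hf x hxP _ (hν _ hx) hxy

theorem ensures_nd {S T : Set (PMF (Option X))} {P : Set X} (hS : Ensures S P)
    (hT : Ensures T P) : Ensures (nd S T) P := by
  intro ξ hξ
  obtain ⟨p, μ, hμ, ν, hν, h⟩ := Set.mem_iUnion.1 hξ
  intro x hx
  rw [PMF.mem_support_iff, h x] at hx
  by_cases h0 : μ x = 0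
  · refine hT ν hν fun h1 => hx ?_
    simp [h0, h1]
  · exact hS μ hμ h0

theorem Ensures.wp_le {f : X → Set (PMF (Option Y))} {x : X} {P : Set Y} (h : Ensures (f x) P)
    {g : Option Y → ℝ≥0∞} {r : ℝ≥0∞} (hr : ∀ y ∈ P, g (some y) ≤ r) : wp f g (some x) ≤ r := by
  refine wp_some_le.2 fun μ hμ => expect_le fun y hy => ?_
  obtain ⟨y, hyP, rfl⟩ := h μ hμ hy
  exact hr y hyP

end General

/-! ## Commands -/

section Commands

variable {Var : Type}

theorem sem_seq (C₁ C₂ : Cmd Var) (σ : State Var) :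
    (Cmd.seq C₁ C₂).sem σ = kleisli C₂.sem (C₁.sem σ) := by simp only [Cmd.sem]

open Classical in
theorem sem_assign (x : Var) (e : Exp Var) (σ : State Var) :
    (Cmd.assign x e).sem σ = unit (some (Function.update σ x (e.eval σ))) := by simp only [Cmd.sem]

/-- This equation is all that is used about loops. Leastness plays no role, since the bound on
failure follows from the unrolling alone. -/
theorem sem_while (e : Exp Var) (C : Cmd Var) (σ : State Var) :
    (Cmd.while e C).sem σ = unroll e C.sem (Cmd.while e C).sem σ := by
  have h := OrderHom.map_lfp (charFun e C.sem)
  have h' : (Cmd.while e C).sem = OrderDual.ofDual (OrderHom.lfp (charFun e C.sem)) := by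
    simp only [Cmd.sem]
  rw [h']
  conv_lhs => rw [← h]
  rfl

theorem sem_while_of_true {e : Exp Var} {σ : State Var} (he : e.eval σ = .bool true)
    (C : Cmd Var) : (Cmd.while e C).sem σ = kleisli (Cmd.while e C).sem (C.sem σ) := by
  rw [sem_while, unroll, if_pos he]

theorem sem_while_of_not {e : Exp Var} {σ : State Var} (he : e.eval σ ≠ .bool true)
    (C : Cmd Var) : (Cmd.while e C).sem σ = unit (some σ) := by
  rw [sem_while, unroll, if_neg he]

theorem wp_seq_le (C₁ C₂ : Cmd Var) (g : Option (State Var) → ℝ≥0∞) :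
    wp (Cmd.seq C₁ C₂).sem g ≤ wp C₁.sem (wp C₂.sem g) := by
  rintro (_ | σ)
  -- At `⊥` the left side is `⨆ y, g y`, which is also the value of `wp C₂.sem g` at `⊥`.
  · exact le_iSup (wp C₂.sem g) none
  · refine le_trans (le_of_eq ?_) (wp_kleisli_le C₁.sem C₂.sem g σ)
    simp only [wp, sem_seq]

theorem wp_unit {f : Den Var} {σ τ : State Var} (h : f σ = unit (some τ))
    (g : Option (State Var) → ℝ≥0∞) : wp f g (some σ) = g (some τ) := by
  have : f σ = {PMF.pure (some τ)} := by
    rw [h]; ext; exact mem_unit_some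
  simp [wp, this, expect_pure]

open Classical in
-- `t` is the outcome hoped for: `a` bounds that branch and `b` the other, whichever of the two
-- comes first in the program.
theorem wp_flipEntry_le {x : Var} {k e : Exp Var} {σ : State Var} {p : ℚ}
    (he : e.eval σ = .num p) (hp : p = 1 / 2) (g : Option (State Var) → ℝ≥0∞) {t : Bool}
    {a b : ℝ≥0∞}
    (ha : g (some (Function.update σ x ((σ x).set (k.eval σ) (.bool t)))) ≤ a)
    (hb : g (some (Function.update σ x ((σ x).set (k.eval σ) (.bool !t)))) ≤ b) :
    wp (flipEntry x k e).sem g (some σ) ≤ 2⁻¹ * (a + b) := by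
  refine wp_some_le.2 fun ξ hξ => ?_
  simp only [flipEntry, Cmd.sem, he] at hξ
  obtain ⟨μ, hμ, ν, hν, h⟩ := hξ
  have hprob : ((Val.num p).prob : ℝ) = 2⁻¹ := by
    subst hp
    have : (2⁻¹ : ℝ) ≤ 1 := by norm_num
    simp [Val.prob, Set.projIcc, this]
  rw [mem_unit_some.1 hμ, mem_unit_some.1 hν] at h
  rw [expect_mix h, expect_pure, expect_pure, hprob]
  have h1 : (1 - 2⁻¹ : ℝ) = 2⁻¹ := by norm_num
  have h2 : ENNReal.ofReal 2⁻¹ = 2⁻¹ := by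
    rw [ENNReal.ofReal_inv_of_pos two_pos]; simp
  rw [h1, h2, ← mul_add]
  simp only [Exp.eval]
  cases t with
  | true => gcongr; exact hb
  | false => rw [add_comm a]; gcongr; exact hb

end Commands
/-! ## Evaluation of the expressions of the solver -/

section Evaluation

theorem Val.index_num (k : ℕ) : (Val.num ((k : ℚ) + 1)).index = some (k + 1) := by
  have h : (k : ℚ) + 1 = ((k + 1 : ℕ) : ℚ) := by push_cast; rfl
  rw [h, Val.index, Rat.den_natCast, Rat.num_natCast, if_pos ⟨rfl, by omega⟩, Int.toNat_natCast]

theorem Val.get_list (l : List Val) (k : ℕ) :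
    (Val.list l).get (.num ((k : ℚ) + 1)) = l.getD k (.num 0) := by
  simp only [Val.get, Val.index_num, Nat.add_sub_cancel]

theorem Val.get_ofFn {n : ℕ} (f : Fin n → Val) (k : Fin n) :
    (Val.list (List.ofFn f)).get (.num (((k : ℕ) : ℚ) + 1)) = f k := by
  rw [Val.get_list, List.getD_eq_getElem _ _ (by simp)]
  simp

theorem Val.exists_set_list (l : List Val) (k : ℕ) (v : Val) :
    ∃ l', (Val.list l).set (.num ((k : ℚ) + 1)) v = .list l' := by
  simp only [Val.set, Val.index_num]
  exact ⟨_, rfl⟩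

/-- No length hypothesis is needed: an update pads with zeros and an access beyond the end reads
zero, so the padding is invisible. -/
theorem Val.get_set_list (l : List Val) (k m : ℕ) (v : Val) :
    ((Val.list l).set (.num ((k : ℚ) + 1)) v).get (.num ((m : ℚ) + 1)) =
      if m = k then v else (Val.list l).get (.num ((m : ℚ) + 1)) := by
  simp only [Val.set, Val.index_num]
  rw [Val.get_list, Val.get_list]
  by_cases hm : m < max (k + 1) l.length
  · rw [List.getD_eq_getElem _ _ (by simpa using hm)]
    simp
  · rw [List.getD_eq_default _ _ (by simpa using hm), List.getD_eq_default _ _ (by omega),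
      if_neg (by omega)]

variable {Var : Type} {N M : ℕ} (V : SolverVars Var) (F : ThreeCNF N M)

/-- Clause `i` is true under the assignment `y`. -/
def ThreeCNF.ClauseTrue (i : Fin M) (y : Fin N → Bool) : Prop := ∃ j, y (F.var i j) = F.sign i j

theorem eval_clvars {σ : State Var} {e : Exp Var} {i : Fin M}
    (he : e.eval σ = .num (((i : ℕ) : ℚ) + 1)) (j : Fin 3) :
    (Exp.get (.get (clvars F) e) (.num (((j : ℕ) : ℚ) + 1))).eval σ =
      .num (((F.var i j : ℕ) : ℚ) + 1) := by
  simp only [Exp.eval, he, clvars, Val.get_ofFn]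

theorem eval_clsigns {σ : State Var} {e : Exp Var} {i : Fin M}
    (he : e.eval σ = .num (((i : ℕ) : ℚ) + 1)) (j : Fin 3) :
    (Exp.get (.get (clsigns F) e) (.num (((j : ℕ) : ℚ) + 1))).eval σ =
      .num (if F.sign i j then 1 else 0) := by
  simp only [Exp.eval, he, clsigns, Val.get_ofFn]

theorem eval_evalLit {σ : State Var} {e : Exp Var} {i : Fin M}
    (he : e.eval σ = .num (((i : ℕ) : ℚ) + 1)) (j : Fin 3) :
    (evalLit V F e (((j : ℕ) : ℚ) + 1)).eval σ =
      .bool (F.sign i j == storedAssignment V σ (F.var i j)) := by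
  have h1 := eval_clvars F he j
  have h2 := eval_clsigns F he j
  unfold evalLit
  rw [Exp.eval, h2, Exp.eval, h1]
  cases F.sign i j <;> simp [Exp.eval, storedAssignment, Val.truth]

open Classical in
theorem eval_evalClause {σ : State Var} {e : Exp Var} {i : Fin M}
    (he : e.eval σ = .num (((i : ℕ) : ℚ) + 1)) :
    (evalClause V F e).eval σ = .bool (decide (F.ClauseTrue i (storedAssignment V σ))) := by
  have h1 := eval_evalLit V F he 0
  have h2 := eval_evalLit V F he 1
  have h3 := eval_evalLit V F he 2
  norm_num at h1 h2 h3
  unfold evalClause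
  rw [Exp.eval, h1, Exp.eval, h2, h3]
  simp only [Val.truth, ThreeCNF.ClauseTrue, Fin.exists_fin_succ, Val.bool.injEq]
  rw [Bool.eq_iff_iff]
  simp [@eq_comm _ (storedAssignment V σ _)]

open Classical in
theorem eval_evalFormula (σ : State Var) :
    (evalFormula V F).eval σ = .bool (decide (F.Satisfies (storedAssignment V σ))) := by
  have key : ∀ l : List (Fin M), (l.foldr (fun (k : Fin M) acc =>
      Exp.and (evalClause V F (.num (((k : ℕ) : ℚ) + 1))) acc) (.bool true)).eval σ =
      .bool (decide (∀ i ∈ l, F.ClauseTrue i (storedAssignment V σ))) := by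
    intro l
    induction l with
    | nil => simp [Exp.eval]
    | cons k l ih =>
      rw [List.foldr_cons, Exp.eval, ih, eval_evalClause V F (i := k) (by simp only [Exp.eval])]
      simp [Val.truth]
  rw [evalFormula, key, Val.bool.injEq, decide_eq_decide]
  simp only [List.mem_finRange, forall_const, ThreeCNF.Satisfies, ThreeCNF.ClauseTrue]

theorem storedAssignment_congr {σ τ : State Var} (h : σ V.vars = τ V.vars) :
    storedAssignment (N := N) V σ = storedAssignment V τ := by
  unfold storedAssignment
  rw [h]

end Evaluation

/-! ## The selection of a clause -/

section Select

variable {Var : Type} {N M : ℕ} (V : SolverVars Var) (F : ThreeCNF N M)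

theorem SolverVars.ne (V : SolverVars Var) :
    V.b ≠ V.s ∧ V.b ≠ V.i ∧ V.b ≠ V.vars ∧ V.s ≠ V.i ∧ V.s ≠ V.vars ∧ V.i ≠ V.vars := by
  have := V.distinct
  simp at this
  tauto

/-- The list `vars` holds `v` and `s` is a clause that is not satisfied. -/
def Selected (v : Val) : Set (State Var) :=
  {σ | σ V.vars = v ∧ ∃ i : Fin M, σ V.s = .num (((i : ℕ) : ℚ) + 1) ∧
    ¬ F.ClauseTrue i (storedAssignment V σ)}

/-- The invariant of the selection loop, when the first `k` clauses have been processed. -/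
def SelectInv (v : Val) (k : ℕ) : Set (State Var) :=
  {σ | σ V.vars = v ∧ σ V.i = .num ((k : ℚ) + 1) ∧ (σ ∈ Selected V F v ∨
    σ V.s = .num (-1) ∧ ∀ i : Fin M, (i : ℕ) < k → F.ClauseTrue i (storedAssignment V σ))}

/-- The body of the selection loop. -/
def selectBody : Cmd Var :=
  .seq
    (.ite (.not (evalClause V F (.var V.i)))
      (.ite (.eq (.var V.s) (.num (-1)))
        (.assign V.s (.var V.i))
        (.nd .skip (.assign V.s (.var V.i))))
      .skip)
    (.assign V.i (.add (.var V.i) (.num 1)))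

theorem update_s_mem_selected {v : Val} {i : Fin M} {σ : State Var} [DecidableEq Var]
    (hv : σ V.vars = v) (hi : ¬ F.ClauseTrue i (storedAssignment V σ)) :
    Function.update σ V.s (.num (((i : ℕ) : ℚ) + 1)) ∈ Selected V F v := by
  obtain ⟨-, -, -, -, hs, -⟩ := V.ne
  refine ⟨by simp [Function.update_of_ne hs.symm, hv], i, by simp, ?_⟩
  rwa [storedAssignment_congr V (Function.update_of_ne hs.symm _ _)]

/-- A false clause met while `s = -1` is always taken. Later choices either keep a false clause or
replace it by another one. -/
theorem ensures_selectBody {v : Val} {σ : State Var} (i : Fin M)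
    (hσ : σ ∈ SelectInv V F v i) :
    Ensures ((selectBody V F).sem σ) (SelectInv V F v (i + 1)) := by
  classical
  obtain ⟨-, -, -, hsi, hs, hiv⟩ := V.ne
  obtain ⟨hv, hi, hsel⟩ := hσ
  rw [selectBody, sem_seq]
  -- Assertion between the test and the increment: clause `i` is processed, but the counter still
  -- points to it.
  refine ensures_kleisli (P := {τ | τ V.vars = v ∧ τ V.i = .num (((i : ℕ) : ℚ) + 1) ∧
    (τ ∈ Selected V F v ∨ τ V.s = .num (-1) ∧ ∀ m : Fin M, (m : ℕ) < i + 1 →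
      F.ClauseTrue m (storedAssignment V τ))}) ?_ ?_
  · have hc := eval_evalClause V F (σ := σ) (e := .var V.i) (i := i) (by simp only [Exp.eval, hi])
    simp only [Cmd.sem]
    by_cases hcl : F.ClauseTrue i (storedAssignment V σ)
    · rw [if_neg (by simp [Exp.eval, hc, Val.truth, hcl])]
      refine ensures_unit ⟨hv, hi, hsel.imp_right fun h => ⟨h.1, fun m hm => ?_⟩⟩
      rcases Nat.lt_succ_iff_lt_or_eq.1 hm with hm | hm
      · exact h.2 m hm
      · rwa [Fin.ext hm]
    · have hup : Ensures (unit (some (Function.update σ V.s ((Exp.var V.i).eval σ))))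
          {τ | τ V.vars = v ∧ τ V.i = .num (((i : ℕ) : ℚ) + 1) ∧
            (τ ∈ Selected V F v ∨ τ V.s = .num (-1) ∧ ∀ m : Fin M, (m : ℕ) < i + 1 →
              F.ClauseTrue m (storedAssignment V τ))} := by
        simp only [Exp.eval, hi]
        exact ensures_unit ⟨by simp [Function.update_of_ne hs.symm, hv],
          by simp [Function.update_of_ne hsi.symm, hi],
          Or.inl (update_s_mem_selected V F hv hcl)⟩
      rw [if_pos (by simp [Exp.eval, hc, Val.truth, hcl])]
      split_ifs with hneg
      · exact hup
      · refine ensures_nd (ensures_unit ⟨hv, hi, Or.inl (hsel.resolve_right fun h => hneg ?_)⟩) hup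
        simp [Exp.eval, h.1]
  · rintro τ ⟨hv, hi, hsel⟩
    rw [sem_assign]
    have hst := storedAssignment_congr (N := N) V (σ := Function.update τ V.i
      ((Exp.add (.var V.i) (.num 1)).eval τ)) (τ := τ) (Function.update_of_ne hiv.symm _ _)
    refine ensures_unit ⟨by simp [Function.update_of_ne hiv.symm, hv],
      by simp [Exp.eval, hi, Val.add], ?_⟩
    simpa only [Selected, Set.mem_ofPred_eq, hst, Function.update_of_ne hiv.symm,
      Function.update_of_ne hsi] using hsel

/-- Induction on the number `n` of clauses left. At the end, `s = -1` would mean that all clauses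
are true. -/
theorem ensures_selectLoop {v : Val} (n : ℕ) : ∀ {k : ℕ} {σ : State Var}, k + n = M →
    ¬ F.Satisfies (storedAssignment V σ) → σ ∈ SelectInv V F v k →
    Ensures ((Cmd.while (.le (.var V.i) (.num M)) (selectBody V F)).sem σ) (Selected V F v) := by
  induction n with
  | zero =>
    intro k σ hk hun hσ
    obtain ⟨hv, hi, hsel⟩ := hσ
    rw [sem_while_of_not]
    · refine ensures_unit (hsel.resolve_right fun h => hun fun i => h.2 i ?_)
      omega
    · have : ¬ ((k : ℚ) + 1 ≤ (M : ℚ)) := by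
        rw [← hk]; push_cast; linarith
      simp [Exp.eval, hi, Val.le, this]
  | succ n ih =>
    intro k σ hk hun hσ
    have hv := hσ.1
    rw [sem_while_of_true]
    · refine ensures_kleisli (ensures_selectBody V F ⟨k, by omega⟩ hσ) fun τ hτ => ?_
      refine ih (by simp only; omega) ?_ hτ
      rwa [storedAssignment_congr V (hτ.1.trans hv.symm)]
    · have : (k : ℚ) + 1 ≤ (M : ℚ) := by exact_mod_cast (by omega : k + 1 ≤ M)
      simp [Exp.eval, hσ.2.1, Val.le, this]

theorem ensures_selClause {σ : State Var} (hun : ¬ F.Satisfies (storedAssignment V σ)) :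
    Ensures ((selClause V F).sem σ) (Selected V F (σ V.vars)) := by
  classical
  obtain ⟨-, -, -, hsi, hs, hiv⟩ := V.ne
  rw [selClause, sem_seq, sem_assign]
  refine ensures_kleisli (ensures_unit (Set.mem_singleton _)) ?_
  rintro _ rfl
  rw [sem_seq, sem_assign]
  refine ensures_kleisli (ensures_unit (Set.mem_singleton _)) ?_
  rintro _ rfl
  refine ensures_selectLoop V F M (k := 0) (zero_add M) ?_ ⟨?_, ?_, Or.inr ⟨?_, ?_⟩⟩
  · rwa [storedAssignment_congr V (τ := σ)]
    simp [Function.update_of_ne hiv.symm, Function.update_of_ne hs.symm]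
  · simp [Function.update_of_ne hiv.symm, Function.update_of_ne hs.symm]
  · simp [Exp.eval]
  · simp [Exp.eval, Function.update_of_ne hsi]
  · intro i hi
    omega

end Select
/-! ## Resampling and the main loop -/

section Resample

variable {Var : Type} {N M : ℕ} (V : SolverVars Var) (F : ThreeCNF N M)

open Classical in
/-- The update of the truth value of `x_k` in the list `vars`. -/
noncomputable def setVar (σ : State Var) (k : Fin N) (t : Bool) : State Var :=
  Function.update σ V.vars ((σ V.vars).set (.num (((k : ℕ) : ℚ) + 1)) (.bool t))

/-- The list `vars` holds a list and `s` holds clause `i`. -/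
def Resampling (i : Fin M) : Set (State Var) :=
  {σ | (∃ l, σ V.vars = .list l) ∧ σ V.s = .num (((i : ℕ) : ℚ) + 1)}

variable {V} in
theorem setVar_mem_resampling {i : Fin M} {σ : State Var} (h : σ ∈ Resampling V i) (k : Fin N)
    (t : Bool) : setVar V σ k t ∈ Resampling V i := by
  obtain ⟨⟨l, hl⟩, hs⟩ := h
  refine ⟨?_, ?_⟩
  · simpa [setVar, hl] using Val.exists_set_list l k (.bool t)
  · classical
    rwa [setVar, Function.update_of_ne V.ne.2.2.2.2.1]

theorem storedAssignment_setVar {σ : State Var} (h : ∃ l, σ V.vars = .list l) (k : Fin N)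
    (t : Bool) :
    storedAssignment V (setVar V σ k t) = Function.update (storedAssignment V σ) k t := by
  obtain ⟨l, hl⟩ := h
  funext m
  simp only [storedAssignment, setVar, Function.update_self, hl, Val.get_set_list,
    Function.update_apply, Fin.ext_iff]
  split_ifs <;> rfl

theorem wp_resampleVar_le {i : Fin M} {σ : State Var} (hσ : σ ∈ Resampling V i) (j : Fin 3)
    {q : ℚ} (hq : q = ((j : ℕ) : ℚ) + 1) (g : Option (State Var) → ℝ≥0∞) (t : Bool)
    {a b : ℝ≥0∞} (ha : g (some (setVar V σ (F.var i j) t)) ≤ a)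
    (hb : ∀ τ ∈ Resampling V i, g (some τ) ≤ b) :
    wp (resampleVar V F q).sem g (some σ) ≤ 2⁻¹ * (a + b) := by
  subst hq
  have hk := eval_clvars F (σ := σ) (e := .var V.s) (i := i) (by simp only [Exp.eval, hσ.2]) j
  have hb' := hb _ (setVar_mem_resampling hσ (F.var i j) (!t))
  refine wp_flipEntry_le (t := t) (by simp only [Exp.eval]) rfl g ?_ ?_
  · rw [hk]; exact ha
  · rw [hk]; exact hb'

theorem wp_resampleVar_le_of_forall {i : Fin M} {σ : State Var} (hσ : σ ∈ Resampling V i)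
    (j : Fin 3) {q : ℚ} (hq : q = ((j : ℕ) : ℚ) + 1) (g : Option (State Var) → ℝ≥0∞)
    {b : ℝ≥0∞} (hb : ∀ τ ∈ Resampling V i, g (some τ) ≤ b) :
    wp (resampleVar V F q).sem g (some σ) ≤ b := by
  refine (wp_resampleVar_le V F hσ j hq g true
    (hb _ (setVar_mem_resampling hσ _ _)) hb).trans_eq ?_
  rw [← two_mul, ← mul_assoc, ENNReal.inv_mul_cancel two_ne_zero ENNReal.ofNat_ne_top, one_mul]

/-- With probability `1 / 8` the three variables of clause `i` receive their values in `x`. -/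
theorem wp_resampleClause_le {i : Fin M} {σ : State Var} (hσ : σ ∈ Resampling V i)
    (x : Fin N → Bool) (g : Option (State Var) → ℝ≥0∞) {a b : ℝ≥0∞}
    (ha : g (some (setVar V (setVar V (setVar V σ (F.var i 0) (x (F.var i 0)))
      (F.var i 1) (x (F.var i 1))) (F.var i 2) (x (F.var i 2)))) ≤ a)
    (hb : ∀ τ ∈ Resampling V i, g (some τ) ≤ b) :
    wp (resampleClause V F).sem g (some σ) ≤ 2⁻¹ * (2⁻¹ * (2⁻¹ * (a + b) + b) + b) := by
  have q0 : (1 : ℚ) = (((0 : Fin 3) : ℕ) : ℚ) + 1 := by norm_num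
  have q1 : (2 : ℚ) = (((1 : Fin 3) : ℕ) : ℚ) + 1 := by norm_num
  have q2 : (3 : ℚ) = (((2 : Fin 3) : ℕ) : ℚ) + 1 := by norm_num
  have h1 := setVar_mem_resampling hσ (F.var i 0) (x (F.var i 0))
  have h2 := setVar_mem_resampling h1 (F.var i 1) (x (F.var i 1))
  -- Once a flip misses `x`, the remaining flips are bounded by `b` whatever their outcomes: `hb2`
  -- serves after the first flip, `hb3` after the second.
  have hb3 := fun τ hτ => wp_resampleVar_le_of_forall V F (σ := τ) hτ 2 q2 g hb
  have hb2 := fun τ hτ => wp_resampleVar_le_of_forall V F (σ := τ) hτ 1 q1 _ hb3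
  refine (wp_seq_le _ _ g _).trans ((wp_mono _ (wp_seq_le _ _ g) _).trans ?_)
  refine wp_resampleVar_le V F hσ 0 q0 _ (x (F.var i 0)) ?_ hb2
  refine wp_resampleVar_le V F h1 1 q1 _ (x (F.var i 1)) ?_ hb3
  exact wp_resampleVar_le V F h2 2 q2 _ (x (F.var i 2)) ha hb

/-! ### The main loop and its failure probability -/

/-- The invariant of the main loop. -/
def MainInv : Set (State Var) :=
  {σ | (∃ l, σ V.vars = .list l) ∧ σ V.b = (evalFormula V F).eval σ}

/-- The body of the main loop. -/
def mainBody : Cmd Var :=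
  .seq (selClause V F) (.seq (resampleClause V F) (.assign V.b (evalFormula V F)))

/-- The main loop. -/
def mainLoop : Cmd Var := .while (.not (.var V.b)) (mainBody V F)

open Classical in
theorem update_b_mem_mainInv {σ : State Var} (h : ∃ l, σ V.vars = .list l) :
    Function.update σ V.b ((evalFormula V F).eval σ) ∈ MainInv V F := by
  have hv : Function.update σ V.b ((evalFormula V F).eval σ) V.vars = σ V.vars :=
    Function.update_of_ne V.ne.2.2.1.symm _ _
  refine ⟨by rwa [hv], ?_⟩
  rw [Function.update_self, eval_evalFormula V F (Function.update _ _ _),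
    storedAssignment_congr V hv, eval_evalFormula]

/-- The variables in which two truth assignments differ. -/
def disagreements (x y : Fin N → Bool) : Finset (Fin N) := {k | y k ≠ x k}

/-- Copying values from `x` creates no disagreement. A literal of clause `i` that is true under `x`
is false under `y`, so its variable is a disagreement that gets repaired. Repeated variables do no
harm, as they receive the same value. -/
theorem card_disagreements_lt {x y : Fin N → Bool} (hx : F.Satisfies x) {i : Fin M}
    (hi : ¬ F.ClauseTrue i y) :
    (disagreements x (Function.update (Function.update (Function.update y
      (F.var i 0) (x (F.var i 0))) (F.var i 1) (x (F.var i 1)))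
      (F.var i 2) (x (F.var i 2)))).card < (disagreements x y).card := by
  obtain ⟨j, hj⟩ := hx i
  refine Finset.card_lt_card (Finset.ssubset_iff_of_subset ?_ |>.2 ⟨F.var i j, ?_, ?_⟩)
  · intro k
    simp only [disagreements, Finset.mem_filter_univ, Function.update_apply]
    split_ifs <;> simp_all
  · simp only [disagreements, Finset.mem_filter_univ]
    exact fun h => hi ⟨j, h.trans hj⟩
  · simp only [disagreements, Finset.mem_filter_univ, Function.update_apply]
    fin_cases j <;> simp only [Fin.zero_eta, Fin.mk_one, Fin.reduceFinMk] <;> split_ifs <;> simp_all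

open Classical in
/-- The indicator of divergence and of the states that do not satisfy the formula. -/
noncomputable def failure : Option (State Var) → ℝ≥0∞
  | some σ => if F.Satisfies (storedAssignment V σ) then 0 else 1
  | none => 1

theorem failure_le_one (y : Option (State Var)) : failure V F y ≤ 1 := by
  cases y with
  | none => exact le_rfl
  | some σ => simp only [failure]; split_ifs <;> simp

theorem eval_guard {σ : State Var} (hσ : σ ∈ MainInv V F) :
    (Exp.not (.var V.b)).eval σ = .bool true ↔ ¬ F.Satisfies (storedAssignment V σ) := by
  simp [Exp.eval, hσ.2, eval_evalFormula, Val.truth]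

/-- The bound is `(a + 7 * b) / 8`: one of the eight outcomes of the flips is sure to bring the
assignment closer to `x`. -/
theorem wp_mainBody_le {x : Fin N → Bool} (hx : F.Satisfies x) {σ : State Var}
    (hσ : ∃ l, σ V.vars = .list l) (hun : ¬ F.Satisfies (storedAssignment V σ)) {d : ℕ}
    (hd : (disagreements x (storedAssignment V σ)).card ≤ d + 1)
    (g : Option (State Var) → ℝ≥0∞) {a b : ℝ≥0∞}
    (ha : ∀ τ ∈ MainInv V F, (disagreements x (storedAssignment V τ)).card ≤ d → g (some τ) ≤ a)
    (hb : ∀ τ ∈ MainInv V F, g (some τ) ≤ b) :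
    wp (mainBody V F).sem g (some σ) ≤ 2⁻¹ * (2⁻¹ * (2⁻¹ * (a + b) + b) + b) := by
  classical
  refine (wp_seq_le _ _ g _).trans ((wp_mono _ (wp_seq_le _ _ g) _).trans ?_)
  -- The adversary is handled here: it suffices to prove the bound for each false clause `i` that
  -- may be selected.
  refine (ensures_selClause V F hun).wp_le ?_
  rintro τ ⟨hv, i, hs, hi⟩
  have hl : ∃ l, τ V.vars = .list l := by rwa [hv]
  have hτ : τ ∈ Resampling V i := ⟨hl, hs⟩
  refine wp_resampleClause_le V F hτ x _ ?_ fun ρ hρ => ?_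
  · have h1 := setVar_mem_resampling hτ (F.var i 0) (x (F.var i 0))
    have h2 := setVar_mem_resampling h1 (F.var i 1) (x (F.var i 1))
    have h3 := setVar_mem_resampling h2 (F.var i 2) (x (F.var i 2))
    rw [wp_unit (sem_assign _ _ _)]
    refine ha _ (update_b_mem_mainInv V F h3.1) ?_
    rw [storedAssignment_congr V (Function.update_of_ne V.ne.2.2.1.symm _ _),
      storedAssignment_setVar V h2.1, storedAssignment_setVar V h1.1,
      storedAssignment_setVar V hl]
    have := card_disagreements_lt F hx hi
    rw [storedAssignment_congr V hv] at this ⊢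
    omega
  · rw [wp_unit (sem_assign _ _ _)]
    exact hb _ (update_b_mem_mainInv V F hρ.1)

theorem half_mul_add_one_lt {c : ℝ≥0∞} (hc : c < 1) : 2⁻¹ * (c + 1) < 1 := by
  have h : 2⁻¹ * (c + 1) < 2⁻¹ * (1 + 1) := by
    refine ENNReal.mul_lt_mul_right (by simp) (by simp) ?_
    exact ENNReal.add_lt_add_right ENNReal.one_ne_top hc
  refine h.trans_eq ?_
  rw [one_add_one_eq_two, ENNReal.inv_mul_cancel two_ne_zero ENNReal.ofNat_ne_top]

/-- The constants start at 0, where the stored assignment is `x` and the loop exits, and obey `c ↦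
(c + 7) / 8`, so `c = 1 - 8⁻ᵈ`. They do not depend on `r`, which may therefore be taken to be the
supremum afterwards. -/
theorem exists_wp_mainLoop_le {x : Fin N → Bool} (hx : F.Satisfies x) (d : ℕ) :
    ∃ c : ℝ≥0∞, c < 1 ∧ ∀ r : ℝ≥0∞,
      (∀ σ ∈ MainInv V F, wp (mainLoop V F).sem (failure V F) (some σ) ≤ r) →
      ∀ σ ∈ MainInv V F, (disagreements x (storedAssignment V σ)).card ≤ d →
        wp (mainLoop V F).sem (failure V F) (some σ) ≤ c * r := by
  have hdone : ∀ σ ∈ MainInv V F, F.Satisfies (storedAssignment V σ) →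
      wp (mainLoop V F).sem (failure V F) (some σ) = 0 := by
    intro σ hσ hsat
    have hg : (Exp.not (.var V.b)).eval σ ≠ .bool true := fun h => (eval_guard V F hσ).1 h hsat
    rw [mainLoop, wp_unit (sem_while_of_not hg _)]
    simp [failure, hsat]
  induction d with
  | zero =>
    refine ⟨0, by simp, fun r _ σ hσ hd => ?_⟩
    rw [hdone σ hσ]
    · simp
    · have : storedAssignment V σ = x := by
        funext k
        by_contra hk
        have : k ∈ disagreements x (storedAssignment V σ) := by simpa [disagreements] using hk
        rw [Finset.card_eq_zero.1 (Nat.le_zero.1 hd)] at this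
        simp at this
      rwa [this]
  | succ d ih =>
    obtain ⟨c, hc, ih⟩ := ih
    refine ⟨2⁻¹ * (2⁻¹ * (2⁻¹ * (c + 1) + 1) + 1), half_mul_add_one_lt (half_mul_add_one_lt
      (half_mul_add_one_lt hc)), fun r hr σ hσ hd => ?_⟩
    by_cases hsat : F.Satisfies (storedAssignment V σ)
    · simp [hdone σ hσ hsat]
    have hun : (mainLoop V F).sem σ = kleisli (mainLoop V F).sem ((mainBody V F).sem σ) :=
      sem_while_of_true ((eval_guard V F hσ).2 hsat) _
    have hle : wp (mainLoop V F).sem (failure V F) (some σ) ≤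
        wp (mainBody V F).sem (wp (mainLoop V F).sem (failure V F)) (some σ) := by
      refine wp_some_le.2 fun ξ hξ => ?_
      rw [hun] at hξ
      obtain ⟨μ, hμ, h⟩ := expect_kleisli_le hξ (failure V F)
      exact h.trans (wp_some_le.1 le_rfl μ hμ)
    -- With `a = c * r` and `b = r` the bound is homogeneous in `r`.
    refine hle.trans ((wp_mainBody_le V F hx hσ.1 hsat hd _ (ih r hr) hr).trans_eq ?_)
    ring

theorem wp_mainLoop_eq_zero (hF : ∃ x : Fin N → Bool, F.Satisfies x) {σ : State Var}
    (hσ : σ ∈ MainInv V F) : wp (mainLoop V F).sem (failure V F) (some σ) = 0 := by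
  obtain ⟨x, hx⟩ := hF
  obtain ⟨c, hc, h⟩ := exists_wp_mainLoop_le V F hx N
  set r := ⨆ σ ∈ MainInv V F, wp (mainLoop V F).sem (failure V F) (some σ) with hr
  have hle : ∀ σ ∈ MainInv V F, wp (mainLoop V F).sem (failure V F) (some σ) ≤ r :=
    fun σ hσ => le_iSup₂_of_le σ hσ le_rfl
  -- Finiteness matters: `r = ∞` could satisfy `r ≤ c * r` with `0 < c < 1`.
  have hr1 : r ≤ 1 := iSup₂_le fun σ _ =>
    wp_some_le.2 fun μ _ => expect_le fun y _ => failure_le_one V F y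
  have hrc : r ≤ c * r := iSup₂_le fun σ hσ =>
    h r hle σ hσ ((Finset.card_le_univ _).trans_eq (Fintype.card_fin N))
  have hr0 : r = 0 := by
    by_contra h0
    have := ENNReal.mul_lt_mul_left h0 (ne_top_of_le_ne_top ENNReal.one_ne_top hr1) hc
    rw [one_mul] at this
    exact absurd hrc this.not_ge
  exact le_antisymm ((hle σ hσ).trans_eq hr0) zero_le

theorem ensures_PRS (hF : ∃ x : Fin N → Bool, F.Satisfies x) {σ : State Var}
    (hσ : ∃ l, σ V.vars = .list l) :
    Ensures ((PRS V F).sem σ) {τ | F.Satisfies (storedAssignment V τ)} := by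
  rw [PRS, sem_seq, sem_assign]
  refine ensures_kleisli (ensures_unit (update_b_mem_mainInv V F hσ)) fun τ hτ μ hμ y hy => ?_
  have h0 : expect μ (failure V F) ≤ 0 :=
    wp_some_le.1 (wp_mainLoop_eq_zero V F hF hτ).le μ hμ
  -- A nonnegative function of expectation zero vanishes at every point of the support.
  have hy0 := ENNReal.tsum_eq_zero.1 (le_antisymm h0 zero_le) y
  have hy1 : failure V F y = 0 := (mul_eq_zero.1 hy0).resolve_left hy
  cases y with
  | none => simp [failure] at hy1
  | some y => exact ⟨y, by simpa [failure] using hy1, rfl⟩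

end Resample

end DemonicOL

theorem mainTheorem10 {Var : Type} [Finite Var] (V : DemonicOL.SolverVars Var)
    {N M : ℕ} (F : DemonicOL.ThreeCNF N M) (hF : ∃ x : Fin N → Bool, F.Satisfies x) :
    DemonicOL.Valid
        (.sure (.isList (.var V.vars)))
        (DemonicOL.PRS V F)
        (.sure (.eq (DemonicOL.evalFormula V F) (.bool true))) ∧
      ∀ σ : DemonicOL.State Var, (∃ l, σ V.vars = .list l) →
        (DemonicOL.PRS V F).AlmostSurelyTerminates σ ∧
          ∀ μ ∈ (DemonicOL.PRS V F).sem σ, ∀ τ : DemonicOL.State Var,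
            some τ ∈ μ.support → F.Satisfies (DemonicOL.storedAssignment V τ) := by
  refine ⟨fun μ hμ => ?_, fun σ hσ => ⟨fun μ hμ hnone => ?_, fun μ hμ τ hτ => ?_⟩⟩
  · simp only [DemonicOL.Assertion.Sat] at hμ ⊢
    refine DemonicOL.ensures_kleisli (P := {σ | ∃ l, σ V.vars = .list l}) ?_ fun σ hσ => ?_
    · rintro ν ⟨μ', rfl, hle⟩
      -- The precondition excludes `⊥`, so the up-closure of the initial distribution contains
      -- nothing new.
      have h0 : μ' none = 0 := by
        by_contra h
        obtain ⟨_, _, h⟩ := hμ h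
        cases h
      rw [DemonicOL.eq_of_distLE hle h0]
      simpa only [DemonicOL.Atom.sem, DemonicOL.Exp.eval] using hμ
    · refine (DemonicOL.ensures_PRS V F hF hσ).mono fun τ hτ => ?_
      have hτ' : F.Satisfies (DemonicOL.storedAssignment V τ) := hτ
      simp [DemonicOL.Atom.sem, DemonicOL.eval_evalFormula, DemonicOL.Exp.eval, hτ']
  · obtain ⟨_, _, h⟩ := DemonicOL.ensures_PRS V F hF hσ μ hμ hnone
    cases h
  · obtain ⟨τ', h, he⟩ := DemonicOL.ensures_PRS V F hF hσ μ hμ hτ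
    cases he
    exact h
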